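/- **Polar decoding graphs.** All graphs are multigraphs. $P_0$ is a single symbol node. For $n\ge 1$, $P_n$ consists of $N=2^n$ symbol nodes $a_0,\dots,a_{N-1}$ and two copies of $P_{n-1}$, with symbol nodes $b_0,\dots,b_{N/2-1}$ and $c_0,\dots,c_{N/2-1}$, where both $a_{2i}$ and $a_{2i+1}$ are joined by an edge to $b_i$ and to $c_i$; only the $a_i$ are the symbol nodes of $P_n$. (So $P_1$ is the "bowtie".) Given a set $\bar{\mathcal A}\subseteq\{0,\dots,N-1\}$ of frozen indices, the *frozen bit polar decoding graph* is obtained from $P_n$ by deleting the symbol nodes with index in $\bar{\mathcal A}$ and their edges; its rate is $1-|\bar{\mathcal A}|/N$. A *polar decoding communication graph* is a graph obtained from it by finitely many operations of the following kinds: adding a vertex, adding an edge, subdividing an edge, contracting two vertices (the edges joining them are deleted, all their other edges are kept), where two symbol nodes are never contracted with one another. Its *output nodes* are the vertices that correspond to the unfrozen symbol nodes. **Circuits.** A *Thompson circuit* consists of finitely many nodes, each occupying one square of the unit grid (distinct nodes occupy distinct squares), and finitely many wires, each joining two different nodes along a path of pairwise distinct squares, consecutive ones sharing a side. A wire runs through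 no node except its two ends, and through each side of a grid square passes at most one wire. Some nodes are designated output nodes. The circuit computes for $T$ clock cycles; in each cycle each wire may pass at most one binary message in each of its two directions. In a cycle, the active squares are those of the wires (including end nodes) on which a message is passed and those of any further nodes that are active. The area $A$ is the number of occupied squares, the switching activity factor $q$ is the fraction of the occupied squares that are active, averaged over the $T$ cycles, and the energy is $E=qAT$. The *communication graph* has the circuit's nodes as vertices and one edge between the two end nodes of the wire for every message passed. An *Arikan polar decoding circuit* (for $n$ and $\bar{\mathcal A}$) is a Thompson circuit whose communication graph is a polar decoding communication graph obtained from the corresponding frozen bit polar decoding graph, with the same output nodes. A *rectangle grid output circuit* is a circuit with $K=s^2$ output nodes for which there is an $s\times s$ array ($s=\sqrt K$) of squares of some integer side length $l\ge1$, aligned with the unit grid, each of which contains exactly one output node. **Theorem.** For every $R>2/3$ there are $c>0$ and $N_0$, depending only on $R$, such that for every $N=2^n\ge N_0$ with $n\ge1$ and every set $\bar{\mathcal A}$ of frozen indices of rate $1-|\bar{\mathcal A}|/N\ge R$, every rectangle grid output, Arikan polar decoding circuit for $n$ and $\bar{\mathcal A}$ has energy $$E\ \ge\ c\,N^{3/2}.$$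 That is, such circuits of rate bounded below by a constant greater than $2/3$ have energy $\Omega(N^{3/2})$. -/

import Mathlib

/-- A multigraph (parallel edges and loops are allowed) with a distinguished set of vertices, its
*symbol nodes*. -/
structure SymbolGraph : Type 1 where
  V : Type
  E : Type
  ends : E → Sym2 V
  symb : Set V

namespace SymbolGraph

/-- Isomorphism of multigraphs that matches the symbol nodes. -/
structure Iso (G H : SymbolGraph) : Type where
  onV : G.V ≃ H.V
  onE : G.E ≃ H.E
  ends_eq : ∀ e, H.ends (onE e) = (G.ends e).map onV
  symb_iff : ∀ v, onV v ∈ H.symb ↔ v ∈ G.symb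

/-- Delete a set of vertices together with all edges that meet it. -/
def deleteVerts (G : SymbolGraph) (D : Set G.V) : SymbolGraph where
  V := {v : G.V // v ∉ D}
  E := {e : G.E // ∀ v ∈ G.ends e, v ∉ D}
  ends e := (G.ends e.1).attachWith e.2
  symb := {v | v.1 ∈ G.symb}

/-- Add one isolated vertex, which is not a symbol node. -/
def addVertex (G : SymbolGraph) : SymbolGraph where
  V := Option G.V
  E := G.E
  ends e := (G.ends e).map some
  symb := some '' G.symb

/-- Add one edge with the given ends. -/
def addEdge (G : SymbolGraph) (z : Sym2 G.V) : SymbolGraph where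
  V := G.V
  E := Option G.E
  ends e := e.elim z G.ends
  symb := G.symb

/-- Replace the edge `e`, whose ends are `u` and `v`, by two edges `u — new`, `new — v`, with a new
vertex (not a symbol node) in the middle. -/
def subdivide (G : SymbolGraph) (e : G.E) (u v : G.V) : SymbolGraph where
  V := Option G.V
  E := {f : G.E // f ≠ e} ⊕ Bool
  ends f :=
    match f with
    | Sum.inl f => (G.ends f.1).map some
    | Sum.inr true => s(some u, none)
    | Sum.inr false => s(none, some v)
  symb := some '' G.symb

open Classical in
/-- Contract `v` into `u` (for `u ≠ v`): the two vertices become one, which keeps the name `u` and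
all edges of both, except that the edges that joined `u` and `v` are deleted. The new vertex is a
symbol node if `u` or `v` was one. -/
noncomputable def contract (G : SymbolGraph) (u v : G.V) (huv : u ≠ v) : SymbolGraph where
  V := {w : G.V // w ≠ v}
  E := {e : G.E // G.ends e ≠ s(u, v)}
  ends e := (G.ends e.1).map fun w => if h : w = v then ⟨u, huv⟩ else ⟨w, h⟩
  symb := {w | w.1 ∈ G.symb ∨ (w.1 = u ∧ v ∈ G.symb)}

/-- `Derives G H`: `H` is obtained from `G`, up to isomorphism, by a finite process in which
vertices and edges are added, edges are subdivided, and pairs of vertices are contracted, where two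
symbol nodes are never contracted with one another. -/
inductive Derives (G : SymbolGraph) : SymbolGraph → Prop
  | refl : Derives G G
  | iso {H K : SymbolGraph} : Derives G H → Iso H K → Derives G K
  | addVertex {H : SymbolGraph} : Derives G H → Derives G H.addVertex
  | addEdge {H : SymbolGraph} (z : Sym2 H.V) : Derives G H → Derives G (H.addEdge z)
  | subdivide {H : SymbolGraph} (e : H.E) (u v : H.V) (he : H.ends e = s(u, v)) :
      Derives G H → Derives G (H.subdivide e u v)
  | contract {H : SymbolGraph} (u v : H.V) (huv : u ≠ v) (hs : ¬ (u ∈ H.symb ∧ v ∈ H.symb)) :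
      Derives G H → Derives G (H.contract u v huv)

end SymbolGraph

/-- Vertices of the `n`-polar decoding graph: `2 ^ n` symbol nodes and, for `n = k + 1`, the vertices
of two copies of the `k`-polar decoding graph. -/
inductive PolarVertex : ℕ → Type
  | sym (n : ℕ) (i : Fin (2 ^ n)) : PolarVertex n
  | sub (n : ℕ) (side : Bool) (v : PolarVertex n) : PolarVertex (n + 1)

/-- Edges of the `n`-polar decoding graph, for `n = k + 1`: one edge from each of the `2 ^ n` symbol
nodes to each of the two copies of the `k`-polar decoding graph, and the edges of these copies. -/
inductive PolarEdge : ℕ → Type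
  | link (n : ℕ) (i : Fin (2 ^ (n + 1))) (side : Bool) : PolarEdge (n + 1)
  | sub (n : ℕ) (side : Bool) (e : PolarEdge n) : PolarEdge (n + 1)

/-- The ends of an edge. The symbol nodes `2 i` and `2 i + 1` (counted from `0`) are both joined to
the `i`-th symbol node of each copy, and these four vertices form a *bowtie*. -/
def PolarEdge.ends : {n : ℕ} → PolarEdge n → Sym2 (PolarVertex n)
  | _, .link n i side =>
      s(.sym (n + 1) i,
        .sub n side (.sym n ⟨i.1 / 2, Nat.div_lt_of_lt_mul (lt_of_lt_of_eq i.2 (pow_succ' 2 n))⟩))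
  | _, .sub n side e => (PolarEdge.ends e).map (PolarVertex.sub n side)

/-- The `n`-polar decoding graph `P_n`. Here `P_0` is a single symbol node, so `P_1` is the bowtie:
two symbol nodes, each joined to each of two further vertices. -/
def polarGraph (n : ℕ) : SymbolGraph where
  V := PolarVertex n
  E := PolarEdge n
  ends := PolarEdge.ends
  symb := Set.range (PolarVertex.sym n)

/-- The `n`-frozen bit polar decoding graph: the symbol nodes with frozen indices are deleted,
together with their edges. -/
def frozenPolarGraph (n : ℕ) (frozen : Finset (Fin (2 ^ n))) : SymbolGraph :=
  (polarGraph n).deleteVerts (PolarVertex.sym n '' (frozen : Set (Fin (2 ^ n))))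

/-- The rate `R = 1 - |frozen| / N`, where `N = 2 ^ n`. -/
noncomputable def polarRate (n : ℕ) (frozen : Finset (Fin (2 ^ n))) : ℝ :=
  1 - (frozen.card : ℝ) / 2 ^ n

/-- Two squares of the unit grid share a side. The pair `(x, y)` stands for the unit square
`[x, x + 1) × [y, y + 1)`. -/
def SharesSide (p q : ℤ × ℤ) : Prop :=
  |p.1 - q.1| + |p.2 - q.2| = 1

/-- A Thompson VLSI circuit together with the computation that it carries out.

Layout: every node occupies one square of the unit grid, and every wire joins two different nodes
and runs through a sequence of pairwise distinct squares, consecutive ones sharing a side; a wire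
does not run through any node except its two end nodes, and through each side of a square there
passes at most one wire (so that a square is used by at most two wires, as where they cross, and a
node has at most four wires).

Computation: there are `T` clock cycles. In each cycle each wire may pass one binary message in
each of its two directions (`true` is from `src` to `dst`; the value `none` means that no message is
passed). Besides the end nodes of the wires in use, the nodes in `busy t` are active in cycle `t`. -/
structure ThompsonCircuit : Type 1 where
  Node : Type
  Wire : Type
  finite_node : Finite Node
  finite_wire : Finite Wire
  /-- the square occupied by a node -/
  pos : Node → ℤ × ℤ
  pos_injective : Function.Injective pos
  src : Wire → Node
  dst : Wire → Node
  src_ne_dst : ∀ w, src w ≠ dst w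
  /-- the number of steps, from square to square, of a wire -/
  len : Wire → ℕ
  /-- the squares of a wire, those of its end nodes included -/
  path : (w : Wire) → Fin (len w + 1) → ℤ × ℤ
  path_first : ∀ w, path w 0 = pos (src w)
  path_last : ∀ w, path w (Fin.last (len w)) = pos (dst w)
  path_step : ∀ w (i : Fin (len w)), SharesSide (path w i.castSucc) (path w i.succ)
  path_injective : ∀ w, Function.Injective (path w)
  path_avoids : ∀ w i v, path w i = pos v → v = src w ∨ v = dst w
  side_disjoint : ∀ w w' (i : Fin (len w)) (j : Fin (len w')),
    s(path w i.castSucc, path w i.succ) = s(path w' j.castSucc, path w' j.succ) → w = w'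
  /-- the output nodes -/
  outputs : Set Node
  /-- the number of clock cycles -/
  T : ℕ
  msg : Fin T → Wire → Bool → Option Bool
  busy : Fin T → Set Node

namespace ThompsonCircuit

/-- The squares occupied by the circuit. -/
def squares (C : ThompsonCircuit) : Set (ℤ × ℤ) :=
  {p | (∃ v, C.pos v = p) ∨ ∃ w i, C.path w i = p}

/-- The area of the circuit: the number of unit squares that it occupies. -/
noncomputable def area (C : ThompsonCircuit) : ℕ := C.squares.ncard

/-- The squares that are active in cycle `t`: those of the wires (end nodes included) on which a
message is passed in at least one direction, and those of the other active nodes. -/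
def activeSquares (C : ThompsonCircuit) (t : Fin C.T) : Set (ℤ × ℤ) :=
  {p | (∃ v ∈ C.busy t, C.pos v = p) ∨
    ∃ w, (∃ d, (C.msg t w d).isSome) ∧ ∃ i, C.path w i = p}

/-- The switching activity factor `q`: the fraction of the circuit that is active per clock cycle,
on average over the clock cycles. -/
noncomputable def activity (C : ThompsonCircuit) : ℝ :=
  (∑ t : Fin C.T, ((C.activeSquares t).ncard : ℝ) / (C.area : ℝ)) / (C.T : ℝ)

/-- The energy `E = q A T`. -/
noncomputable def energy (C : ThompsonCircuit) : ℝ :=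
  C.activity * (C.area : ℝ) * (C.T : ℝ)

/-- The communication graph of the computation: its vertices are the nodes of the circuit, and each
binary message that is passed gives one edge between the two nodes concerned. -/
def communicationGraph (C : ThompsonCircuit) : SymbolGraph where
  V := C.Node
  E := {m : Fin C.T × C.Wire × Bool // (C.msg m.1 m.2.1 m.2.2).isSome}
  ends m := s(C.src m.1.2.1, C.dst m.1.2.1)
  symb := C.outputs

/-- The circuit is an Arikan polar decoding circuit for block length `2 ^ n` and the given frozen
indices: its communication graph arises from the frozen bit polar decoding graph by the permitted
operations, and its output nodes are the vertices that correspond to the unfrozen symbol nodes. -/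
def IsArikanPolarDecoder (C : ThompsonCircuit) (n : ℕ) (frozen : Finset (Fin (2 ^ n))) : Prop :=
  (frozenPolarGraph n frozen).Derives C.communicationGraph

/-- The circuit is a rectangle grid output circuit: it has `s ^ 2` output nodes, and on the unit grid
one can place an aligned `s × s` array of larger squares, of integer side length `l ≥ 1`, each of
which contains exactly one output node. -/
def IsRectangleGridOutput (C : ThompsonCircuit) : Prop :=
  ∃ s l : ℕ, 1 ≤ l ∧ C.outputs.ncard = s ^ 2 ∧ ∃ x y : ℤ, ∀ i < s, ∀ j < s,
    ∃! v : C.Node, v ∈ C.outputs ∧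
      (x + i * l ≤ (C.pos v).1 ∧ (C.pos v).1 < x + (i + 1) * l) ∧
      (y + j * l ≤ (C.pos v).2 ∧ (C.pos v).2 < y + (j + 1) * l)

end ThompsonCircuit

/-! The heart is a cut bound: if a two-colouring of the polar graph gives at least `m` unfrozen
symbol nodes to each colour, at least `2 m` surviving edges are cut. Every symbol node has one
descending path to each of the `2 ^ n` last-level vertices, and every edge lies on exactly `2 ^ (n -
1)` such paths. Each symbol-leaf pair of different colours forces a cut edge on its path, and there
are at least `m * 2 ^ n` such pairs, whatever the colours of the leaves (`sum_leafCount_le`,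
`two_mul_le_card_polarCut`).

The permitted operations never lower the size of a cut and keep the symbol nodes distinct
(`IsCutMap`), so the bound passes to the communication graph.

For the circuit, colour nodes by the side of the vertical line at the left edge of the `j`-th column
of cells. At least `j * s` outputs lie on the left and `(s - j) * s` on the right, so at least `2 *
min j (s - j) * s` messages cross. Each crossing uses an active square just right of the line, and
such a square serves at most two crossings per cycle. These columns of squares are disjoint for
different `j`, and the energy is the total number of active squares; summing over `j` gives order `s
^ 3`, where `s ^ 2` is the number of unfrozen symbols, at least `R * 2 ^ n`. -/

namespace SymbolGraph

/-! ### Cuts under the permitted graph operations -/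

/-- The edges whose ends get different colours. -/
def cutEdges (G : SymbolGraph) (χ : G.V → Bool) : Set G.E :=
  {e | ¬ ((G.ends e).map χ).IsDiag}

/-- `f` matches the symbol nodes of `G` with those of `H`, and every two-colouring of `H` cuts at
least as many edges as the colouring of `G` that it induces along `f`. -/
structure IsCutMap (G H : SymbolGraph) (f : G.V → H.V) : Prop where
  bijOn : Set.BijOn f G.symb H.symb
  cut : ∀ χ : H.V → Bool, Nonempty (G.cutEdges (χ ∘ f) ↪ H.cutEdges χ)

theorem IsCutMap.id (G : SymbolGraph) : G.IsCutMap G id :=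
  ⟨Set.bijOn_id _, fun _ => ⟨Function.Embedding.refl _⟩⟩

theorem IsCutMap.comp {G H K : SymbolGraph} {g : H.V → K.V} {f : G.V → H.V}
    (hg : H.IsCutMap K g) (hf : G.IsCutMap H f) : G.IsCutMap K (g ∘ f) :=
  ⟨hg.bijOn.comp hf.bijOn, fun χ =>
    let ⟨a⟩ := hg.cut χ
    let ⟨b⟩ := hf.cut (χ ∘ g)
    ⟨b.trans a⟩⟩

theorem IsCutMap.of_edgeMap {G H : SymbolGraph} {f : G.V → H.V}
    (hf : Set.BijOn f G.symb H.symb)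
    (h : ∀ χ : H.V → Bool, ∃ φ : G.cutEdges (χ ∘ f) → H.E, Function.Injective φ ∧
      ∀ e, φ e ∈ H.cutEdges χ) : G.IsCutMap H f :=
  ⟨hf, fun χ =>
    let ⟨φ, hi, hm⟩ := h χ
    ⟨⟨fun e => ⟨φ e, hm e⟩, fun _ _ hab => hi (congrArg Subtype.val hab)⟩⟩⟩

theorem Iso.isCutMap {G H : SymbolGraph} (i : Iso G H) : G.IsCutMap H i.onV := by
  refine .of_edgeMap ⟨fun v hv => (i.symb_iff v).2 hv, i.onV.injective.injOn, fun w hw => ?_⟩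
    fun χ => ⟨fun e => i.onE e.1, fun _ _ h => Subtype.ext (i.onE.injective h), fun e => ?_⟩
  · exact ⟨i.onV.symm w, (i.symb_iff _).1 (by simpa using hw), by simp⟩
  · have := e.2
    simpa [cutEdges, i.ends_eq, Sym2.map_map] using this

theorem isCutMap_addVertex (G : SymbolGraph) : G.IsCutMap G.addVertex some := by
  refine .of_edgeMap ⟨fun v hv => ⟨v, hv, rfl⟩, (Option.some_injective _).injOn, fun w hw => hw⟩
    fun (χ : Option G.V → Bool) => ⟨fun e => e.1, fun _ _ h => Subtype.ext h, fun e => ?_⟩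
  change ¬ (Sym2.map χ (Sym2.map (some : G.V → Option G.V) (G.ends e.1))).IsDiag
  rw [Sym2.map_map]
  exact e.2

theorem isCutMap_addEdge (G : SymbolGraph) (z : Sym2 G.V) : G.IsCutMap (G.addEdge z) _root_.id :=
  .of_edgeMap (Set.bijOn_id _)
    fun _ => ⟨fun e => some e.1, fun _ _ h => Subtype.ext (Option.some_injective _ h),
      fun e => e.2⟩

/-- If `u` and `v` differ in colour, the new middle vertex differs from at least one of them, so one
half of a cut edge is again cut. -/
theorem isCutMap_subdivide (G : SymbolGraph) (e : G.E) (u v : G.V) (he : G.ends e = s(u, v)) :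
    G.IsCutMap (G.subdivide e u v) some := by
  classical
  refine .of_edgeMap ⟨fun v hv => ⟨v, hv, rfl⟩, (Option.some_injective _).injOn, fun w hw => hw⟩
    fun (χ : Option G.V → Bool) => ?_
  -- The subdivided edge goes to its half at `u` if that half is cut, and to its half at `v`
  -- otherwise.
  let φ : G.E → {f : G.E // f ≠ e} ⊕ Bool := fun f =>
    if h : f = e then .inr (decide (χ (some u) ≠ χ none)) else .inl ⟨f, h⟩
  have φe : φ e = .inr (decide (χ (some u) ≠ χ none)) := dif_pos rfl
  have φn : ∀ f (h : f ≠ e), φ f = .inl ⟨f, h⟩ := fun f h => dif_neg h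
  refine ⟨fun f => φ f.1, fun a b h => Subtype.ext ?_, fun ⟨f, hf⟩ => ?_⟩
  · dsimp only at h
    by_cases h₁ : a.1 = e <;> by_cases h₂ : b.1 = e
    · exact h₁.trans h₂.symm
    · rw [h₁, φe, φn _ h₂] at h
      cases h
    · rw [h₂, φe, φn _ h₁] at h
      cases h
    · rw [φn _ h₁, φn _ h₂] at h
      exact Subtype.mk.inj (Sum.inl.inj h)
  · dsimp only
    by_cases h : f = e
    · subst h
      have hf : ¬ (Sym2.map (χ ∘ some) (G.ends f)).IsDiag := hf
      rw [he, Sym2.map_mk, Sym2.mk_isDiag_iff] at hf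
      rw [φe]
      by_cases h' : χ (some u) = χ none
      · rw [decide_eq_false (not_not.2 h')]
        change ¬ (Sym2.map χ (s(none, some v) : Sym2 (Option G.V))).IsDiag
        rw [Sym2.map_mk, Sym2.mk_isDiag_iff, ← h']
        exact hf
      · rw [decide_eq_true h']
        change ¬ (Sym2.map χ (s(some u, none) : Sym2 (Option G.V))).IsDiag
        rwa [Sym2.map_mk, Sym2.mk_isDiag_iff]
    · rw [φn f h]
      change ¬ (Sym2.map χ (Sym2.map (some : G.V → Option G.V) (G.ends f))).IsDiag
      rw [Sym2.map_map]
      exact hf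

/-- The deleted edges join `u` to `v`, which have the same colour in an induced colouring, so no cut
edge is lost. Injectivity on symbol nodes is where the ban on contracting two of them enters. -/
theorem exists_isCutMap_contract (G : SymbolGraph) (u v : G.V) (huv : u ≠ v)
    (hs : ¬ (u ∈ G.symb ∧ v ∈ G.symb)) : ∃ f, G.IsCutMap (G.contract u v huv) f := by
  classical
  let f : G.V → (G.contract u v huv).V := fun w => if h : w = v then ⟨u, huv⟩ else ⟨w, h⟩
  have fv : f v = ⟨u, huv⟩ := dif_pos rfl
  have fn : ∀ w (h : w ≠ v), f w = ⟨w, h⟩ := fun w h => dif_neg h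
  refine ⟨f, .of_edgeMap ⟨fun w hw => ?_, fun a ha b hb hab => ?_, ?_⟩
    fun χ => ⟨fun e => ⟨e.1, fun h => e.2 ?_⟩,
      fun _ _ h => Subtype.ext (congrArg (fun z : {e // G.ends e ≠ s(u, v)} => z.1) h), fun e => ?_⟩⟩
  · by_cases h : w = v
    · subst h
      rw [fv]
      exact Or.inr ⟨rfl, hw⟩
    · rw [fn w h]
      exact Or.inl hw
  · by_cases h₁ : a = v <;> by_cases h₂ : b = v
    · rw [h₁, h₂]
    · subst h₁
      rw [fv, fn b h₂] at hab
      have : u = b := congrArg Subtype.val hab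
      exact absurd ⟨this ▸ hb, ha⟩ hs
    · subst h₂
      rw [fv, fn a h₁] at hab
      have : a = u := congrArg Subtype.val hab
      exact absurd ⟨this ▸ ha, hb⟩ hs
    · rw [fn a h₁, fn b h₂] at hab
      exact congrArg Subtype.val hab
  · rintro ⟨w, hw⟩ (h | ⟨h, hv⟩)
    · exact ⟨w, h, fn w hw⟩
    · have h : w = u := h
      subst h
      exact ⟨v, hv, fv⟩
  · rw [h]
    simp [fv, fn u huv]
  · have := e.2
    change ¬ (Sym2.map χ ((G.ends e.1).map f)).IsDiag
    rw [Sym2.map_map]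
    exact this

theorem Derives.exists_isCutMap {G H : SymbolGraph} (h : Derives G H) :
    ∃ f, G.IsCutMap H f := by
  induction h with
  | refl => exact ⟨_, .id G⟩
  | iso _ i ih => exact ih.imp' _ fun _ hf => i.isCutMap.comp hf
  | addVertex _ ih => exact ih.imp' _ fun _ hf => (isCutMap_addVertex _).comp hf
  | addEdge z _ ih => exact ih.imp' _ fun _ hf => (isCutMap_addEdge _ z).comp hf
  | subdivide e u v he _ ih =>
    exact ih.imp' _ fun _ hf => (isCutMap_subdivide _ e u v he).comp hf
  | contract u v huv hs _ ih =>
    obtain ⟨f, hf⟩ := ih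
    obtain ⟨g, hg⟩ := exists_isCutMap_contract _ u v huv hs
    exact ⟨_, hg.comp hf⟩

end SymbolGraph

/-! ### Cuts of the polar decoding graph -/

instance finite_polarEdge (n : ℕ) : Finite (PolarEdge n) := by
  induction n with
  | zero => exact @Finite.of_fintype _ ⟨∅, fun e => nomatch e⟩
  | succ n ih =>
    refine Finite.of_surjective (α := (Fin (2 ^ (n + 1)) × Bool) ⊕ (Bool × PolarEdge n))
      (Sum.elim (fun p => .link n p.1 p.2) fun p => .sub n p.1 p.2) fun e => ?_
    cases e with
    | link _ i side => exact ⟨.inl (i, side), rfl⟩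
    | sub _ side e => exact ⟨.inr (side, e), rfl⟩

/-- The number of vertices of colour `b` among the `2 ^ n` vertices of the last level of the
`n`-polar decoding graph. -/
def leafCount : (n : ℕ) → (PolarVertex n → Bool) → Bool → ℕ
  | 0, χ, b => if χ (.sym 0 0) = b then 1 else 0
  | n + 1, χ, b => ∑ side, leafCount n (fun v => χ (.sub n side v)) b

theorem leafCount_add_not (n : ℕ) (χ : PolarVertex n → Bool) (b : Bool) :
    leafCount n χ b + leafCount n χ (!b) = 2 ^ n := by
  induction n with
  | zero => cases b <;> cases h : χ (.sym 0 0) <;> simp [leafCount, h]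
  | succ n ih =>
    rw [leafCount, leafCount, ← Finset.sum_add_distrib]
    simp [ih, pow_succ, mul_comm]

theorem leafCount_le (n : ℕ) (χ : PolarVertex n → Bool) (b : Bool) : leafCount n χ b ≤ 2 ^ n :=
  (Nat.le_add_right _ _).trans (leafCount_add_not n χ b).le

/-- The symbol node of a copy of the `n`-polar decoding graph to which the `i`-th symbol node of the
`n + 1`-polar decoding graph is linked. -/
def halfIndex (n : ℕ) (i : Fin (2 ^ (n + 1))) : Fin (2 ^ n) :=
  ⟨i.1 / 2, Nat.div_lt_of_lt_mul (lt_of_lt_of_eq i.2 (pow_succ' 2 n))⟩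

/-- Each `j` is the half index of only `2 * j` and `2 * j + 1`. -/
theorem sum_halfIndex_le (n : ℕ) (U : Finset (Fin (2 ^ (n + 1)))) (g : Fin (2 ^ n) → ℕ) :
    ∑ i ∈ U, g (halfIndex n i) ≤ 2 * ∑ j, g j := by
  classical
  rw [← Finset.sum_fiberwise_of_maps_to (s := U) (t := Finset.univ) (g := halfIndex n)
    (fun _ _ => Finset.mem_univ _), Finset.mul_sum]
  refine Finset.sum_le_sum fun j _ => ?_
  rw [Finset.sum_congr rfl (g := fun _ => g j)
    fun i hi => by rw [(Finset.mem_filter.1 hi).2], Finset.sum_const, smul_eq_mul]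
  refine Nat.mul_le_mul_right _ ?_
  have : ({i ∈ U | halfIndex n i = j}.map Fin.valEmbedding) ⊆ {2 * j.1, 2 * j.1 + 1} := by
    intro k hk
    simp only [Finset.mem_map, Finset.mem_filter, Fin.valEmbedding_apply] at hk
    obtain ⟨i, ⟨-, h⟩, rfl⟩ := hk
    have : i.1 / 2 = j.1 := congrArg Fin.val h
    simp only [Finset.mem_insert, Finset.mem_singleton]
    omega
  simpa using (Finset.card_le_card this).trans Finset.card_le_two

/-- The edges of the `n`-polar decoding graph that join vertices of different colours and that meet
no symbol node with index outside `U`. -/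
def polarCut (n : ℕ) (χ : PolarVertex n → Bool) (U : Finset (Fin (2 ^ n))) : Set (PolarEdge n) :=
  {e | (∀ i, PolarVertex.sym n i ∈ e.ends → i ∈ U) ∧ ¬ (e.ends.map χ).IsDiag}

/-- The cut links and the cut edges of the two copies are disjoint families. The copies carry
`Finset.univ` because freezing affects only the top level. -/
theorem card_polarCut_succ (n : ℕ) (χ : PolarVertex (n + 1) → Bool)
    (U : Finset (Fin (2 ^ (n + 1)))) :
    ∑ side, (∑ i ∈ U, (if χ (.sym _ i) = χ (.sub n side (.sym n (halfIndex n i))) then 0 else 1) +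
      (polarCut n (fun v => χ (.sub n side v)) Finset.univ).ncard) ≤ (polarCut (n + 1) χ U).ncard := by
  classical
  let A (side : Bool) : Set (PolarEdge (n + 1)) := (fun i => PolarEdge.link n i side) ''
    (({i ∈ U | χ (.sym _ i) ≠ χ (.sub n side (.sym n (halfIndex n i)))} : Finset _) : Set _)
  let B (side : Bool) : Set (PolarEdge (n + 1)) :=
    PolarEdge.sub n side '' polarCut n (fun v => χ (.sub n side v)) Finset.univ
  have hA (side : Bool) : (A side).ncard =
      ∑ i ∈ U, if χ (.sym _ i) = χ (.sub n side (.sym n (halfIndex n i))) then 0 else 1 := by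
    rw [Set.ncard_image_of_injective _ fun i j h => by cases h; rfl, Set.ncard_coe_finset,
      Finset.card_filter]
    simp
  have hB (side : Bool) : (B side).ncard =
      (polarCut n (fun v => χ (.sub n side v)) Finset.univ).ncard :=
    Set.ncard_image_of_injective _ fun i j h => by cases h; rfl
  have hAB (side : Bool) : Disjoint (A side) (B side) := by
    rw [Set.disjoint_left]
    rintro _ ⟨i, -, rfl⟩ ⟨e, -, h⟩
    cases h
  have hD : Disjoint (A true ∪ B true) (A false ∪ B false) := by
    rw [Set.disjoint_left]
    rintro _ (⟨i, -, rfl⟩ | ⟨e, -, rfl⟩) (⟨j, -, h⟩ | ⟨f, -, h⟩) <;> cases h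
  have hsub (side : Bool) : A side ∪ B side ⊆ polarCut (n + 1) χ U := by
    rintro _ (⟨i, hi, rfl⟩ | ⟨e, he, rfl⟩)
    · simp only [Finset.coe_filter, Set.mem_ofPred_eq] at hi
      refine ⟨fun j hj => ?_, ?_⟩
      · rw [PolarEdge.ends, Sym2.mem_iff] at hj
        rcases hj with hj | hj <;> cases hj
        exact hi.1
      · rw [PolarEdge.ends, Sym2.map_mk, Sym2.mk_isDiag_iff]
        exact hi.2
    · refine ⟨fun j hj => ?_, ?_⟩
      · rw [PolarEdge.ends, Sym2.mem_map] at hj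
        obtain ⟨w, -, hw⟩ := hj
        cases hw
      · have := he.2
        rw [PolarEdge.ends, Sym2.map_map]
        exact this
  rw [Fintype.sum_bool, ← hA, ← hA, ← hB, ← hB, ← Set.ncard_union_eq (hAB _),
    ← Set.ncard_union_eq (hAB _), ← Set.ncard_union_eq hD]
  exact Set.ncard_le_ncard (Set.union_subset (hsub _) (hsub _))

/-- Double counting of bichromatic symbol-leaf pairs, each of which has a cut edge on its path,
while an edge lies on `2 ^ n / 2` paths. The factor 2 on the left avoids this division. -/
theorem sum_leafCount_le (n : ℕ) (χ : PolarVertex n → Bool) (U : Finset (Fin (2 ^ n))) :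
    2 * ∑ i ∈ U, leafCount n χ (!χ (.sym n i)) ≤ 2 ^ n * (polarCut n χ U).ncard := by
  induction n with
  | zero =>
    rw [Finset.sum_eq_zero]
    · simp
    · intro i _
      have : i = 0 := Fin.ext (by simp)
      simp [leafCount, this]
  | succ n ih =>
    refine le_trans ?_ (Nat.mul_le_mul_left _ (card_polarCut_succ n χ U))
    simp only [leafCount]
    rw [Finset.sum_comm, Finset.mul_sum, Finset.mul_sum]
    refine Finset.sum_le_sum fun side _ => ?_
    -- If the link is not cut, the symbol node may be replaced by its neighbour in the copy; if it
    -- is cut, it pays for all `2 ^ n` leaves of the copy.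
    have key : ∑ i ∈ U, leafCount n (fun v => χ (.sub n side v)) (!χ (.sym (n + 1) i)) ≤
        ∑ i ∈ U, (2 ^ n *
          (if χ (.sym _ i) = χ (.sub n side (.sym n (halfIndex n i))) then 0 else 1) +
          leafCount n (fun v => χ (.sub n side v)) (!χ (.sub n side (.sym n (halfIndex n i))))) := by
      refine Finset.sum_le_sum fun i _ => ?_
      split_ifs with h
      · rw [h]
        exact Nat.le_add_left _ _
      · rw [mul_one]
        exact (leafCount_le _ _ _).trans (Nat.le_add_right _ _)
    rw [Finset.sum_add_distrib, ← Finset.mul_sum] at key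
    have h₁ := sum_halfIndex_le n U
      fun j => leafCount n (fun v => χ (.sub n side v)) (!χ (.sub n side (.sym n j)))
    have h₂ := ih (fun v => χ (.sub n side v)) Finset.univ
    have arith (Q L A B D Z : ℕ) (hL : L ≤ Q * A + D) (hD : D ≤ 2 * Z) (hZ : 2 * Z ≤ Q * B) :
        2 * L ≤ 2 * Q * (A + B) := by
      linarith
    exact (arith _ _ _ _ _ _ key h₁ h₂).trans_eq (congrArg (· * _) (pow_succ' 2 n).symm)

/-- A two-colouring of the polar decoding graph with `p` and `q` symbol nodes of the two colours in
`U` cuts at least `2 min p q` edges. -/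
theorem two_mul_le_card_polarCut (n : ℕ) (χ : PolarVertex n → Bool) (U : Finset (Fin (2 ^ n)))
    (m : ℕ) (hm : ∀ b, m ≤ {i ∈ U | χ (.sym n i) = b}.card) :
    2 * m ≤ (polarCut n χ U).ncard := by
  have h := sum_leafCount_le n χ U
  rw [← Finset.sum_fiberwise U (fun i => χ (.sym n i)), Fintype.sum_bool] at h
  have hs (b : Bool) : ∑ i ∈ U with χ (.sym n i) = b, leafCount n χ (!χ (.sym n i)) =
      {i ∈ U | χ (.sym n i) = b}.card * leafCount n χ (!b) := by
    rw [Finset.sum_congr rfl (g := fun _ => leafCount n χ (!b))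
      fun i hi => by rw [(Finset.mem_filter.1 hi).2], Finset.sum_const, smul_eq_mul]
  rw [hs, hs] at h
  -- Each colour class has at least `m` symbol nodes and the two leaf counts add up to `2 ^ n`, so
  -- there are at least `m * 2 ^ n` bichromatic pairs.
  have h₁ := Nat.mul_le_mul_right (leafCount n χ (!true)) (hm true)
  have h₂ := Nat.mul_le_mul_right (leafCount n χ (!false)) (hm false)
  have h₃ := congrArg (m * ·) (leafCount_add_not n χ false)
  simp only [mul_add, Bool.not_false, Bool.not_true] at h₁ h₂ h₃ h
  refine Nat.le_of_mul_le_mul_left ?_ (pow_pos (zero_lt_two' ℕ) n)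
  linarith


/-! ### Energy and messages across vertical lines -/

namespace ThompsonCircuit

theorem finite_squares (C : ThompsonCircuit) : C.squares.Finite := by
  have := C.finite_node
  have := C.finite_wire
  refine ((Set.finite_range C.pos).union
    (Set.finite_range fun p : Σ w, Fin (C.len w + 1) => C.path p.1 p.2)).subset ?_
  rintro p (⟨v, h⟩ | ⟨w, i, h⟩)
  · exact Or.inl ⟨v, h⟩
  · exact Or.inr ⟨⟨w, i⟩, h⟩

theorem activeSquares_subset (C : ThompsonCircuit) (t : Fin C.T) :
    C.activeSquares t ⊆ C.squares := by
  rintro p (⟨v, -, h⟩ | ⟨w, -, h⟩)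
  · exact Or.inl ⟨v, h⟩
  · exact Or.inr ⟨w, h⟩

theorem finite_activeSquares (C : ThompsonCircuit) (t : Fin C.T) : (C.activeSquares t).Finite :=
  C.finite_squares.subset (C.activeSquares_subset t)

/-- The normalisations by area and by `T` cancel. When either is zero there are no active squares to
count, so the identity survives division by zero. -/
theorem energy_eq (C : ThompsonCircuit) :
    C.energy = ∑ t : Fin C.T, ((C.activeSquares t).ncard : ℝ) := by
  rw [energy, activity, ← Finset.sum_div]
  by_cases hT : C.T = 0
  · have : IsEmpty (Fin C.T) := by rw [hT]; infer_instance
    simp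
  by_cases hA : C.area = 0
  · have h (t : Fin C.T) : (C.activeSquares t).ncard = 0 :=
      Nat.le_zero.1 ((Set.ncard_le_ncard (C.activeSquares_subset t) C.finite_squares).trans hA.le)
    simp [h]
  · have hT : (C.T : ℝ) ≠ 0 := Nat.cast_ne_zero.2 hT
    have hA : (C.area : ℝ) ≠ 0 := Nat.cast_ne_zero.2 hA
    field_simp

/-- The colouring of the nodes by the side of the vertical line at `X` on which they lie. -/
def leftOf (C : ThompsonCircuit) (X : ℤ) (v : C.Node) : Bool :=
  decide ((C.pos v).1 < X)

/-- The active squares in cycle `t` that lie directly to the right of the vertical line at `X`. -/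
def activeColumn (C : ThompsonCircuit) (t : Fin C.T) (X : ℤ) : Set (ℤ × ℤ) :=
  {p ∈ C.activeSquares t | p.1 = X}

/-- A path that changes sides has a step that does so. The square `p` on its right determines the
side crossed, hence by `side_disjoint` the wire. -/
theorem exists_step_across (C : ThompsonCircuit) (X : ℤ) (w : C.Wire)
    (hw : C.leftOf X (C.src w) ≠ C.leftOf X (C.dst w)) :
    ∃ p : ℤ × ℤ, p.1 = X ∧ (∃ i, C.path w i = p) ∧ ∃ i : Fin (C.len w),
      s(C.path w i.castSucc, C.path w i.succ) = s((X - 1, p.2), p) := by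
  have h : ∃ i : Fin (C.len w),
      ¬ ((C.path w i.castSucc).1 < X ↔ (C.path w i.succ).1 < X) := by
    by_contra! h
    have key (i : Fin (C.len w + 1)) : (C.path w 0).1 < X ↔ (C.path w i).1 < X := by
      induction i using Fin.induction with
      | zero => rfl
      | succ i ih => exact ih.trans (h i)
    refine hw ?_
    rw [leftOf, leftOf, ← C.path_first, ← C.path_last]
    exact decide_eq_decide.2 (key _)
  obtain ⟨i, hi⟩ := h
  have hs := C.path_step w i
  have step (a b : ℤ × ℤ) (hab : SharesSide a b) (ha : a.1 < X) (hb : ¬ b.1 < X) :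
      b.1 = X ∧ a = (X - 1, b.2) := by
    obtain ⟨a₁, a₂⟩ := a
    obtain ⟨b₁, b₂⟩ := b
    simp only [SharesSide] at hab ha hb
    simp only [Prod.mk.injEq]
    rcases abs_cases (a₁ - b₁) with h₁ | h₁ <;> rcases abs_cases (a₂ - b₂) with h₂ | h₂ <;> omega
  by_cases h₁ : (C.path w i.castSucc).1 < X
  · have h₂ : ¬ (C.path w i.succ).1 < X := fun h => hi (iff_of_true h₁ h)
    obtain ⟨hX, h⟩ := step _ _ hs h₁ h₂
    exact ⟨_, hX, ⟨_, rfl⟩, i, by rw [← h]⟩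
  · have h₂ : (C.path w i.succ).1 < X := by
      by_contra h
      exact hi (iff_of_false h₁ h)
    have hs' : SharesSide (C.path w i.succ) (C.path w i.castSucc) := by
      rw [SharesSide, abs_sub_comm, abs_sub_comm (C.path w i.succ).2]
      exact hs
    obtain ⟨hX, h⟩ := step _ _ hs' h₂ h₁
    exact ⟨_, hX, ⟨_, rfl⟩, i, by rw [← h, Sym2.eq_swap]⟩

/-- The messages passed across a vertical line are at most twice as many as the active squares
directly to its right, over all clock cycles. -/
theorem card_messages_across_le (C : ThompsonCircuit) (X : ℤ) :
    Nat.card {m : C.communicationGraph.E // C.leftOf X (C.src m.1.2.1) ≠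
      C.leftOf X (C.dst m.1.2.1)} ≤ 2 * ∑ t, (C.activeColumn t X).ncard := by
  classical
  choose! p hX hp i hi using C.exists_step_across X
  have (t : Fin C.T) : Finite (C.activeColumn t X) :=
    ((C.finite_activeSquares t).subset (Set.sep_subset _ _)).to_subtype
  -- A crossing message is recovered from its direction, its cycle and the square that its wire
  -- enters just right of the line; the two directions give the factor 2.
  let φ : {m : C.communicationGraph.E // C.leftOf X (C.src m.1.2.1) ≠
      C.leftOf X (C.dst m.1.2.1)} → Bool × Σ t, C.activeColumn t X := fun m =>
    (m.1.1.2.2, ⟨m.1.1.1, p m.1.1.2.1,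
      Or.inr ⟨m.1.1.2.1, ⟨_, m.1.2⟩, hp _ m.2⟩, hX _ m.2⟩)
  have hφ : Function.Injective φ := by
    rintro ⟨⟨⟨t, w, d⟩, h⟩, hm⟩ ⟨⟨⟨t', w', d'⟩, h'⟩, hm'⟩ heq
    have h₁ : d = d' := congrArg Prod.fst heq
    have h₂ : t = t' := congrArg (fun z => z.2.1) heq
    have h₃ : p w = p w' := congrArg (fun z => z.2.2.1) heq
    have h₄ : w = w' :=
      C.side_disjoint w w' (i w hm) (i w' hm') (by rw [hi w hm, hi w' hm', h₃])
    subst h₁ h₂ h₄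
    rfl
  refine (Nat.card_le_card_of_injective φ hφ).trans ?_
  rw [Nat.card_prod, Nat.card_sigma, Nat.card_eq_fintype_card, Fintype.card_bool]
  rfl

theorem sum_activeColumn_le (C : ThompsonCircuit) (t : Fin C.T) {ι : Type*} (J : Finset ι)
    (X : ι → ℤ) (hX : Function.Injective X) :
    ∑ j ∈ J, (C.activeColumn t (X j)).ncard ≤ (C.activeSquares t).ncard := by
  classical
  rw [Set.ncard_eq_toFinset_card _ (C.finite_activeSquares t)]
  have h (j : ι) : (C.activeColumn t (X j)).ncard =
      {p ∈ (C.finite_activeSquares t).toFinset | p.1 = X j}.card := by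
    rw [← Set.ncard_coe_finset]
    congr 1
    ext
    simp [activeColumn]
  simp_rw [h]
  rw [← Finset.card_biUnion]
  · refine Finset.card_le_card fun p hp => ?_
    obtain ⟨j, -, hj⟩ := Finset.mem_biUnion.1 hp
    exact (Finset.mem_filter.1 hj).1
  · intro i _ j _ hij
    rw [Function.onFun, Finset.disjoint_left]
    intro p hi hj
    exact hij (hX ((Finset.mem_filter.1 hi).2.symm.trans (Finset.mem_filter.1 hj).2))

/-- If `M j` messages are passed across the `j`-th of a family of vertical lines, then the energy is
at least half of the sum of the `M j`. -/
theorem sum_card_messages_le (C : ThompsonCircuit) {ι : Type*} (J : Finset ι) (X : ι → ℤ)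
    (hX : Function.Injective X) (M : ι → ℕ)
    (hM : ∀ j ∈ J, 2 * M j ≤ Nat.card {m : C.communicationGraph.E // C.leftOf (X j)
      (C.src m.1.2.1) ≠ C.leftOf (X j) (C.dst m.1.2.1)}) :
    ((∑ j ∈ J, M j : ℕ) : ℝ) ≤ C.energy := by
  rw [energy_eq, ← Nat.cast_sum, Nat.cast_le]
  calc ∑ j ∈ J, M j ≤ ∑ j ∈ J, ∑ t, (C.activeColumn t (X j)).ncard := by
        refine Finset.sum_le_sum fun j hj => ?_
        have := (hM j hj).trans (C.card_messages_across_le (X j))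
        omega
    _ = ∑ t, ∑ j ∈ J, (C.activeColumn t (X j)).ncard := Finset.sum_comm
    _ ≤ _ := Finset.sum_le_sum fun t _ => C.sum_activeColumn_le t J X hX

/-- In an array of cells with one output node each, the cells of a set `I` of columns contain at
least `|I| s` output nodes. -/
theorem card_mul_le_ncard_outputs (C : ThompsonCircuit) (s l : ℕ) (x y : ℤ)
    (h : ∀ i < s, ∀ j < s, ∃ v : C.Node, v ∈ C.outputs ∧
      (x + i * l ≤ (C.pos v).1 ∧ (C.pos v).1 < x + (i + 1) * l) ∧
      (y + j * l ≤ (C.pos v).2 ∧ (C.pos v).2 < y + (j + 1) * l))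
    (I : Finset ℕ) (hI : ∀ i ∈ I, i < s) (S : Set C.Node)
    (hS : ∀ i ∈ I, ∀ v ∈ C.outputs, x + i * l ≤ (C.pos v).1 → (C.pos v).1 < x + (i + 1) * l →
      v ∈ S) : I.card * s ≤ S.ncard := by
  have := C.finite_node
  rcases isEmpty_or_nonempty C.Node with hC | hC
  · rcases I.eq_empty_or_nonempty with rfl | ⟨i, hi⟩
    · simp
    · have hi := hI i hi
      exact (hC.false (h i hi i hi).choose).elim
  -- The cells are half-open and disjoint, so the chosen outputs are distinct.
  choose! v hv using h
  have cell (z a : ℤ) (i j : ℕ) (h₁ : z + i * l ≤ a ∧ a < z + (i + 1) * l)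
      (h₂ : z + j * l ≤ a ∧ a < z + (j + 1) * l) : i = j := by
    have aux (i j : ℕ) (h₁ : z + i * l ≤ a) (h₂ : a < z + (j + 1) * l) : i ≤ j := by
      have : (i : ℤ) * l < (j + 1) * l := by linarith
      have := lt_of_mul_lt_mul_right this (Int.natCast_nonneg l)
      omega
    exact le_antisymm (aux i j h₁.1 h₂.2) (aux j i h₂.1 h₁.2)
  rw [← Finset.card_range s, ← Finset.card_product, ← Set.ncard_coe_finset]
  refine Set.ncard_le_ncard_of_injOn (fun q => v q.1 q.2) ?_ ?_ S.toFinite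
  · intro q hq
    simp only [Finset.coe_product, Set.mem_prod, Finset.mem_coe, Finset.mem_range] at hq
    obtain ⟨h₁, h₂, -⟩ := hv q.1 (hI _ hq.1) q.2 hq.2
    exact hS _ hq.1 _ h₁ h₂.1 h₂.2
  · intro q hq r hr hqr
    simp only [Finset.coe_product, Set.mem_prod, Finset.mem_coe, Finset.mem_range] at hq hr
    have h₁ := (hv q.1 (hI _ hq.1) q.2 hq.2).2
    have h₂ := (hv r.1 (hI _ hr.1) r.2 hr.2).2
    have hqr : v q.1 q.2 = v r.1 r.2 := hqr
    rw [hqr] at h₁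
    exact Prod.ext (cell _ _ _ _ h₁.1 h₂.1) (cell _ _ _ _ h₁.2 h₂.2)

end ThompsonCircuit

/-! ### From the polar graph to the communication graph -/

theorem mem_frozenPolarGraph_symb {n : ℕ} {frozen : Finset (Fin (2 ^ n))}
    {v : (frozenPolarGraph n frozen).V} :
    v ∈ (frozenPolarGraph n frozen).symb ↔ ∃ i ∈ frozenᶜ, .sym n i = v.1 := by
  refine ⟨fun ⟨i, hi⟩ => ⟨i, Finset.mem_compl.2 fun h => v.2 ⟨i, h, hi⟩, hi⟩,
    fun ⟨i, _, hi⟩ => ⟨i, hi⟩⟩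

theorem sym_notMem_frozen {n : ℕ} {frozen : Finset (Fin (2 ^ n))} {i : Fin (2 ^ n)}
    (hi : i ∈ frozenᶜ) : PolarVertex.sym n i ∉ PolarVertex.sym n '' (frozen : Set (Fin (2 ^ n))) := by
  rintro ⟨j, hj, h⟩
  cases h
  exact Finset.mem_compl.1 hi hj

theorem exists_polarCut_embedding (n : ℕ) (frozen : Finset (Fin (2 ^ n)))
    (χ : PolarVertex n → Bool) :
    Nonempty (polarCut n χ frozenᶜ ↪
      (frozenPolarGraph n frozen).cutEdges fun v => χ v.1) := by
  have h (e : polarCut n χ frozenᶜ) :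
      ∀ v ∈ e.1.ends, v ∉ PolarVertex.sym n '' (frozen : Set (Fin (2 ^ n))) := by
    rintro _ hv ⟨i, hi, rfl⟩
    exact Finset.mem_compl.1 (e.2.1 i hv) hi
  refine ⟨⟨fun e => ⟨⟨e.1, h e⟩, ?_⟩, fun a b hab => Subtype.ext ?_⟩⟩
  · change ¬ (Sym2.map (χ ∘ Subtype.val) (e.1.ends.attachWith (h e))).IsDiag
    rw [← Sym2.map_map, Sym2.attachWith_map_subtypeVal]
    exact e.2.2
  · exact congrArg (fun z : {e : PolarEdge n //
      ∀ v ∈ e.ends, v ∉ PolarVertex.sym n '' (frozen : Set (Fin (2 ^ n)))} => z.1)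
      (congrArg Subtype.val hab)

theorem ncard_symb_of_derives {n : ℕ} {frozen : Finset (Fin (2 ^ n))} {H : SymbolGraph}
    (h : (frozenPolarGraph n frozen).Derives H) :
    H.symb.ncard = frozenᶜ.card := by
  obtain ⟨f, hf⟩ := h.exists_isCutMap
  rw [← hf.bijOn.image_eq, hf.bijOn.injOn.ncard_image, ← Set.ncard_coe_finset]
  refine (Set.ncard_congr (fun i hi => ⟨.sym n i, sym_notMem_frozen hi⟩) ?_ ?_ ?_).symm
  · exact fun i hi => ⟨i, rfl⟩
  · intro i j hi hj hij
    cases congrArg Subtype.val hij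
    rfl
  · intro v hv
    obtain ⟨i, hi, hv⟩ := mem_frozenPolarGraph_symb.1 hv
    exact ⟨i, hi, Subtype.ext hv⟩

/-- A two-colouring of a polar decoding communication graph with at least `m` symbol nodes of each
colour cuts at least `2 m` edges. -/
theorem two_mul_le_card_cutEdges {n : ℕ} {frozen : Finset (Fin (2 ^ n))} {H : SymbolGraph}
    (h : (frozenPolarGraph n frozen).Derives H)
    [Finite H.E] (χ : H.V → Bool) (m : ℕ)
    (hm : ∀ b, m ≤ {v ∈ H.symb | χ v = b}.ncard) : 2 * m ≤ Nat.card (H.cutEdges χ) := by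
  classical
  obtain ⟨f, hf⟩ := h.exists_isCutMap
  -- The value `false` at deleted vertices is harmless: neither the edges in `polarCut n ψ frozenᶜ`
  -- nor the symbol nodes counted involve them.
  let ψ : PolarVertex n → Bool := fun v =>
    if hv : v ∉ PolarVertex.sym n '' (frozen : Set (Fin (2 ^ n))) then χ (f ⟨v, hv⟩) else false
  have hψ : (fun v : (frozenPolarGraph n frozen).V => ψ v.1) = χ ∘ f :=
    funext fun v => dif_pos v.2
  have hle : 2 * m ≤ (polarCut n ψ frozenᶜ).ncard := by
    refine two_mul_le_card_polarCut n ψ frozenᶜ m fun b => (hm b).trans ?_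
    have hsub : {v ∈ H.symb | χ v = b} ⊆ f '' {v | v ∈ (frozenPolarGraph n frozen).symb ∧
        ψ v.1 = b} := by
      rintro _ ⟨hw, hb⟩
      obtain ⟨v, hv, rfl⟩ := hf.bijOn.surjOn hw
      exact ⟨v, ⟨hv, (congrFun hψ v).trans hb⟩, rfl⟩
    have hsub' : Subtype.val '' {v | v ∈ (frozenPolarGraph n frozen).symb ∧ ψ v.1 = b} ⊆
        PolarVertex.sym n '' (({i ∈ frozenᶜ | ψ (.sym n i) = b} : Finset _) : Set _) := by
      rintro _ ⟨v, ⟨hv, hb⟩, rfl⟩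
      obtain ⟨i, hi, hv⟩ := mem_frozenPolarGraph_symb.1 hv
      exact ⟨i, Finset.mem_coe.2 (Finset.mem_filter.2 ⟨hi, hv ▸ hb⟩), hv⟩
    have hfin := ((Finset.finite_toSet _).image _).subset hsub'
    calc _ ≤ _ := Set.ncard_le_ncard hsub
          ((hfin.of_finite_image Subtype.val_injective.injOn).image f)
      _ ≤ _ := Set.ncard_image_le (hfin.of_finite_image Subtype.val_injective.injOn)
      _ = _ := (Set.ncard_image_of_injective _ Subtype.val_injective).symm
      _ ≤ _ := Set.ncard_le_ncard hsub' ((Finset.finite_toSet _).image _)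
      _ ≤ _ := Set.ncard_image_le (Finset.finite_toSet _)
      _ = _ := Set.ncard_coe_finset _
  obtain ⟨a⟩ := exists_polarCut_embedding n frozen ψ
  rw [hψ] at a
  obtain ⟨b⟩ := hf.cut χ
  exact hle.trans (Nat.card_le_card_of_injective _ (a.trans b).injective)

/-! ### Summation over the lines and the final bound -/

/-- `s` is kept separate from the upper limit `m` so that induction applies; at `m = s` the right
side is `s ^ 3 - s`. -/
theorem six_mul_sum_range (s : ℝ) (m : ℕ) :
    6 * ∑ j ∈ Finset.range m, (j : ℝ) * (s - j) =
    3 * s * m * (m - 1) - (m - 1) * m * (2 * m - 1) := by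
  induction m with
  | zero => simp
  | succ m ih =>
    rw [Finset.sum_range_succ, mul_add, ih]
    push_cast
    ring

theorem ThompsonCircuit.cube_le_energy (C : ThompsonCircuit) (n : ℕ)
    (frozen : Finset (Fin (2 ^ n))) (hC : C.IsArikanPolarDecoder n frozen) (s l : ℕ) (hs : 2 ≤ s)
    (hl : 1 ≤ l) (x y : ℤ) (hcell : ∀ i < s, ∀ j < s, ∃ v : C.Node, v ∈ C.outputs ∧
      (x + i * l ≤ (C.pos v).1 ∧ (C.pos v).1 < x + (i + 1) * l) ∧
      (y + j * l ≤ (C.pos v).2 ∧ (C.pos v).2 < y + (j + 1) * l)) :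
    (s : ℝ) ^ 3 / 8 ≤ C.energy := by
  have := C.finite_wire
  have : Finite C.communicationGraph.E :=
    inferInstanceAs (Finite {m : Fin C.T × C.Wire × Bool // (C.msg m.1 m.2.1 m.2.2).isSome})
  have hl' : (0 : ℤ) < l := by exact_mod_cast hl
  have hX : Function.Injective fun j : ℕ => x + j * (l : ℤ) := fun i j hij => by
    have : (i : ℤ) * l = j * l := add_left_cancel hij
    exact_mod_cast mul_right_cancel₀ hl'.ne' this
  have hcut (j : ℕ) (hj : j < s) : 2 * (min j (s - j) * s) ≤
      Nat.card {m : C.communicationGraph.E // C.leftOf (x + j * l) (C.src m.1.2.1) ≠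
        C.leftOf (x + j * l) (C.dst m.1.2.1)} := by
    have key := two_mul_le_card_cutEdges hC (C.leftOf (x + j * l)) (min j (s - j) * s) ?_
    · refine key.trans_eq (Nat.card_congr (Equiv.subtypeEquivRight fun m => ?_))
      exact not_congr (Sym2.mk_isDiag_iff (x := C.leftOf (x + j * l) (C.src m.1.2.1)))
    · rintro (_ | _)
      · refine (Nat.mul_le_mul_right s (min_le_right _ _)).trans ?_
        rw [← Nat.card_Ico]
        refine C.card_mul_le_ncard_outputs s l x y hcell _ (fun i hi => (Finset.mem_Ico.1 hi).2) _
          fun i hi v hv h₁ _ => ⟨hv, decide_eq_false ?_⟩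
        have : (j : ℤ) * l ≤ i * l :=
          mul_le_mul_of_nonneg_right (by exact_mod_cast (Finset.mem_Ico.1 hi).1) hl'.le
        linarith
      · refine (Nat.mul_le_mul_right s (min_le_left _ _)).trans ?_
        rw [← Finset.card_range j]
        refine C.card_mul_le_ncard_outputs s l x y hcell _
          (fun i hi => (Finset.mem_range.1 hi).trans hj) _
          fun i hi v hv _ h₂ => ⟨hv, decide_eq_true ?_⟩
        rw [Finset.card_range]
        have : ((i : ℤ) + 1) * l ≤ j * l :=
          mul_le_mul_of_nonneg_right (by exact_mod_cast Finset.mem_range.1 hi) hl'.le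
        linarith
  have hE := C.sum_card_messages_le (Finset.range s) _ hX (fun j => min j (s - j) * s)
    fun j hj => hcut j (Finset.mem_range.1 hj)
  refine le_trans ?_ hE
  -- Here `j * (s - j)` is the product of the minimum and the maximum of `j` and `s - j`, and the
  -- maximum is at most `s`.
  have hsum : ∑ j ∈ Finset.range s, (j : ℝ) * (s - j) ≤
      ((∑ j ∈ Finset.range s, min j (s - j) * s : ℕ) : ℝ) := by
    rw [Nat.cast_sum]
    refine Finset.sum_le_sum fun j hj => ?_
    have hj := (Finset.mem_range.1 hj).le
    rw [← Nat.cast_sub hj, ← Nat.cast_mul, Nat.cast_le, ← min_mul_max j (s - j)]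
    exact Nat.mul_le_mul_left _ (max_le hj (Nat.sub_le _ _))
  have h6 := six_mul_sum_range s s
  have hs' : (2 : ℝ) ≤ s := by exact_mod_cast hs
  -- The claim `s ^ 3 / 8 ≤ (s ^ 3 - s) / 6` amounts to `0 ≤ s * (s - 2) * (s + 2)`, whence `2 ≤ s`.
  nlinarith [mul_nonneg (by linarith : (0 : ℝ) ≤ s)
    (mul_nonneg (sub_nonneg.2 hs') (by linarith : (0 : ℝ) ≤ s + 2))]

theorem mainTheorem2 (R : ℝ) (hR : 2 / 3 < R) :
    ∃ c : ℝ, 0 < c ∧ ∃ N₀ : ℕ, ∀ n : ℕ, 1 ≤ n → N₀ ≤ 2 ^ n →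
      ∀ frozen : Finset (Fin (2 ^ n)), R ≤ polarRate n frozen →
        ∀ C : ThompsonCircuit, C.IsRectangleGridOutput → C.IsArikanPolarDecoder n frozen →
          c * ((2 : ℝ) ^ n) ^ (3 / 2 : ℝ) ≤ C.energy := by
  have hR₀ : 0 < R := by linarith
  refine ⟨R ^ (3 / 2 : ℝ) / 8, by positivity, 0, ?_⟩
  rintro n hn - frozen hrate C ⟨s, l, hl, hs, x, y, hcell⟩ hC
  have hK : (R * 2 ^ n : ℝ) ≤ (s : ℝ) ^ 2 := by
    have h₁ : frozenᶜ.card = s ^ 2 := (ncard_symb_of_derives hC).symm.trans hs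
    rw [Finset.card_compl, Fintype.card_fin] at h₁
    have h₂ : frozen.card ≤ 2 ^ n := by simpa using frozen.card_le_univ
    have h₃ : ((2 : ℝ) ^ n) - frozen.card = (s : ℝ) ^ 2 := by
      rw [← Nat.cast_pow, ← h₁, Nat.cast_sub h₂]
      simp
    have h₄ := mul_le_mul_of_nonneg_right hrate (pow_nonneg zero_le_two n)
    rwa [polarRate, sub_mul, one_mul, div_mul_cancel₀ _ (by positivity), h₃] at h₄
  -- Since `2 / 3 < R` and `2 ≤ 2 ^ n`, there is more than one output; this is why `N₀ = 0`
  -- suffices.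
  have hs₂ : 2 ≤ s := by
    have h₁ : (2 : ℝ) ≤ 2 ^ n := le_self_pow₀ one_le_two (by omega)
    have h₂ : (1 : ℝ) < (s : ℝ) ^ 2 := by nlinarith
    have h₃ : 1 < s ^ 2 := by exact_mod_cast h₂
    by_contra! h
    interval_cases s <;> simp at h₃
  refine le_trans ?_ (C.cube_le_energy n frozen hC s l hs₂ hl x y
    fun i hi j hj => (hcell i hi j hj).exists)
  rw [div_mul_eq_mul_div, ← Real.mul_rpow hR₀.le (by positivity)]
  have h := Real.rpow_le_rpow (by positivity) hK (by norm_num : (0 : ℝ) ≤ 3 / 2)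
  rw [← Real.rpow_natCast (s : ℝ), ← Real.rpow_mul (Nat.cast_nonneg s)] at h
  norm_num at h
  linarith
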